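/- Let $n\ge 1$, $T>0$, $\gamma>0$, and let $A,G,\Gamma,Q,H\in\mathbb R^{n\times n}$, where $Q$ and $H$ are symmetric and positive semi-definite. Put $\widehat Q=(I-\Gamma)^TQ(I-\Gamma)$. For $g\in L^2(0,T;\mathbb R^n)$ let $z$ be the solution on $[0,T]$ of $$\dot z=(A+G)z+g,\qquad z(0)=0,$$ and put $$\bar J''(g)=\int_0^T\Big\{-z^T\widehat Q z+\frac1\gamma|g(t)|^2\Big\}\,dt-z(T)^THz(T).$$ The following statements are equivalent. (i) There exists $\epsilon_0>0$ such that $\bar J''(g)-\epsilon_0\int_0^T|g(t)|^2\,dt\ge 0$ for all $g\in L^2(0,T;\mathbb R^n)$. (ii) The Riccati equation $$\dot P+(A+G)^TP+P(A+G)-\gamma P^2-\widehat Q=0,\qquad P(T)=-H,$$ has a unique solution $P:[0,T]\to\mathbb R^{n\times n}$ on $[0,T]$. (iii) For every $t\in[0,T]$, $$\det\big\{(0,I)\,e^{\mathcal A t}\,(0,I)^T\big\}>0,$$ where $(0,I)\in\mathbb R^{n\times 2n}$, $$\mathcal A=\begin{pmatrix}A+G+\gamma H&-\gamma I\\ \breve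 Q&-(A+G+\gamma H)^T\end{pmatrix},\qquad \breve Q=\gamma H^2+\widehat Q+(A+G)^TH+H(A+G).$$ -/

import Mathlib

open MeasureTheory Set

noncomputable section

/-- The matrix `Q̂ = (I - Γ)ᵀ Q (I - Γ)`. -/
def hatQ {n : ℕ} (Q Γ : Matrix (Fin n) (Fin n) ℝ) : Matrix (Fin n) (Fin n) ℝ :=
  (1 - Γ).transpose * Q * (1 - Γ)

/-- `z` is the state on `[0, T]` of `ż = F z + g`, `z(0) = 0`, driven by `g`. As `g` is only square
integrable, the equation is meant in the usual integrated form (`z` absolutely continuous and the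
differential equation valid almost everywhere). -/
def IsState {n : ℕ} (F : Matrix (Fin n) (Fin n) ℝ) (T : ℝ)
    (g z : ℝ → EuclideanSpace ℝ (Fin n)) : Prop :=
  ContinuousOn z (Icc 0 T) ∧
    ∀ t ∈ Icc (0 : ℝ) T, z t = ∫ s in (0 : ℝ)..t, (Matrix.toEuclideanCLM (𝕜 := ℝ) F (z s) + g s)

/-- The cost `∫₀ᵀ (-zᵀ Q̂ z + γ⁻¹ |g|²) dt - z(T)ᵀ H z(T)` of a control `g` with state `z`. -/
def auxCost {n : ℕ} (Qhat H : Matrix (Fin n) (Fin n) ℝ) (γ T : ℝ)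
    (g z : ℝ → EuclideanSpace ℝ (Fin n)) : ℝ :=
  (∫ t in (0 : ℝ)..T,
      (-(inner ℝ (z t) (Matrix.toEuclideanCLM (𝕜 := ℝ) Qhat (z t))) + 1 / γ * ‖g t‖ ^ 2))
    - inner ℝ (z T) (Matrix.toEuclideanCLM (𝕜 := ℝ) H (z T))

/-- Uniform convexity: for some `ε₀ > 0` the functional that sends `g ∈ L²(0, T; ℝⁿ)` to its cost
minus `ε₀ ‖g‖²_{L²}` is positive semi-definite. -/
def UniformConvexity {n : ℕ} (F Qhat H : Matrix (Fin n) (Fin n) ℝ) (γ T : ℝ) : Prop :=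
  ∃ ε₀ : ℝ, 0 < ε₀ ∧
    ∀ g z : ℝ → EuclideanSpace ℝ (Fin n),
      MemLp g 2 (volume.restrict (Icc 0 T)) → IsState F T g z →
        0 ≤ auxCost Qhat H γ T g z - ε₀ * ∫ t in (0 : ℝ)..T, ‖g t‖ ^ 2

/-- `P` solves `Ṗ + Fᵀ P + P F - γ P² - Q̂ = 0` on `[0, T]` with `P(T) = -H` (one-sided derivatives
at the end points; the derivative of a matrix-valued function is taken entry by entry). -/
def IsRiccatiSolution {n : ℕ} (F Qhat H : Matrix (Fin n) (Fin n) ℝ) (γ T : ℝ)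
    (P : ℝ → Matrix (Fin n) (Fin n) ℝ) : Prop :=
  (∃ P' : ℝ → Matrix (Fin n) (Fin n) ℝ, ∀ t ∈ Icc (0 : ℝ) T,
      (∀ i j, HasDerivWithinAt (fun s => P s i j) (P' t i j) (Icc 0 T) t) ∧
      P' t + F.transpose * P t + P t * F - γ • (P t ^ 2) - Qhat = 0) ∧
    P T = -H

/-- The Riccati terminal value problem has exactly one solution on `[0, T]`. -/
def RiccatiUniquelySolvable {n : ℕ} (F Qhat H : Matrix (Fin n) (Fin n) ℝ) (γ T : ℝ) : Prop :=
  ∃ P, IsRiccatiSolution F Qhat H γ T P ∧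
    ∀ P', IsRiccatiSolution F Qhat H γ T P' → EqOn P' P (Icc 0 T)

/-- The block matrix `(F + γH, -γI; Q̆, -(F + γH)ᵀ)` with `Q̆ = γH² + Q̂ + Fᵀ H + H F`. -/
def hamiltonianMatrix {n : ℕ} (F Qhat H : Matrix (Fin n) (Fin n) ℝ) (γ : ℝ) :
    Matrix (Fin n ⊕ Fin n) (Fin n ⊕ Fin n) ℝ :=
  Matrix.fromBlocks (F + γ • H) (-(γ • (1 : Matrix (Fin n) (Fin n) ℝ)))
    (γ • H ^ 2 + Qhat + F.transpose * H + H * F) (-(F + γ • H).transpose)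

/-- The row block matrix `(0, I)`. -/
def zeroOneRow (n : ℕ) : Matrix (Fin n) (Fin n ⊕ Fin n) ℝ :=
  Matrix.fromCols 0 1

end

/-! Write F = A + G. The functional has the Hamiltonian system ż = Fz − γp, ṗ = Q̂z − Fᵀp, p(T) =
−Hz(T). The substitution Y = p + Hz makes the terminal condition Y(T) = 0 and the coefficient matrix
𝒜. With (X, Y) = exp((t − T)𝒜)(I, 0), all three statements are tied to the invertibility of X on [0,
T].

The determinant in (iii) is det X(T − t), because 𝒜 is Hamiltonian (`det_zeroOneRow_exp`). As X(T) =
I, continuity makes "nonzero" and "positive" equivalent on [0, T] (`det_stateBlock_pos_iff`).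

(i) ⇒ (iii): a kernel vector of X(t₀) yields an extremal with z(t₀) = 0. Switched on only after t₀,
it is admissible and has cost zero, so coercivity makes it vanish
(`UniformConvexity.extremal_eq_zero`). (iii) ⇒ (ii): P = YX⁻¹ − H solves the Riccati equation, and
Grönwall gives uniqueness (`IsRiccatiSolution.eqOn`). (ii) ⇒ (i): completing the square turns the
cost into γ⁻¹∫|g + γPz|² (`IsRiccatiSolution.auxCost_eq`), and g is bounded in L² by g + γPz
(`IsRiccatiSolution.uniformConvexity`). -/

/-! ### The Hamiltonian flow and its blocks. -/

open scoped Matrix.Norms.L2Operator in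
theorem hasDerivAt_exp_sub_smul {m : Type*} [Fintype m] [DecidableEq m] (M : Matrix m m ℝ)
    (T t : ℝ) :
    HasDerivAt (fun s : ℝ => NormedSpace.exp ((s - T) • M))
      (M * NormedSpace.exp ((t - T) • M)) t := by
  have h := (hasDerivAt_exp_smul_const' (𝕂 := ℝ) M (t - T)).scomp t ((hasDerivAt_id t).sub_const T)
  simpa [Function.comp_def] using h

/-- The exponential of a Hamiltonian matrix and its inverse are conjugate up to transposition, which
exchanges the diagonal blocks. -/
theorem exp_neg_hamiltonianMatrix_toBlocks₁₁ {n : ℕ} {F Qhat H : Matrix (Fin n) (Fin n) ℝ} {γ : ℝ}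
    (hQ : Qhat.transpose = Qhat) (hH : H.transpose = H) (t : ℝ) :
    (NormedSpace.exp ((-t) • hamiltonianMatrix F Qhat H γ)).toBlocks₁₁ =
      (NormedSpace.exp (t • hamiltonianMatrix F Qhat H γ)).toBlocks₂₂.transpose := by
  -- The symplectic unit. The off-diagonal blocks of the Hamiltonian matrix M are symmetric, so U Mᵀ
  -- U⁻¹ = −M.
  set U : Matrix (Fin n ⊕ Fin n) (Fin n ⊕ Fin n) ℝ := Matrix.fromBlocks 0 1 (-1) 0 with hU
  set V : Matrix (Fin n ⊕ Fin n) (Fin n ⊕ Fin n) ℝ := Matrix.fromBlocks 0 (-1) 1 0 with hV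
  have hUV : U * V = 1 := by
    simp [hU, hV, Matrix.fromBlocks_multiply, ← Matrix.fromBlocks_one]
  have hUinv : U⁻¹ = V := Matrix.inv_eq_right_inv hUV
  have hunit : IsUnit U := IsUnit.of_mul_eq_one V hUV
  have hconj : U * (t • hamiltonianMatrix F Qhat H γ).transpose * U⁻¹ =
      (-t) • hamiltonianMatrix F Qhat H γ := by
    rw [hUinv, hU, hV, hamiltonianMatrix, Matrix.transpose_smul, Matrix.fromBlocks_transpose]
    simp only [Matrix.fromBlocks_smul, Matrix.fromBlocks_multiply]
    congr 1 <;> simp [hQ, hH, add_comm, add_left_comm]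
  rw [← hconj, Matrix.exp_conj _ _ hunit, Matrix.exp_transpose, hUinv]
  set E := NormedSpace.exp (t • hamiltonianMatrix F Qhat H γ)
  rw [← Matrix.fromBlocks_toBlocks E, hU, hV, Matrix.fromBlocks_transpose]
  simp [Matrix.fromBlocks_multiply]

theorem zeroOneRow_mul_mul_transpose {n : ℕ} (M : Matrix (Fin n ⊕ Fin n) (Fin n ⊕ Fin n) ℝ) :
    zeroOneRow n * M * (zeroOneRow n).transpose = M.toBlocks₂₂ := by
  conv_lhs => rw [← Matrix.fromBlocks_toBlocks M]
  rw [zeroOneRow, Matrix.fromCols_mul_fromBlocks, Matrix.transpose_fromCols,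
    Matrix.fromCols_mul_fromRows]
  simp

/-- The state block `X` of the solution `(X, Y) = exp ((t - T) 𝒜) (I, 0)` of the Hamiltonian
system. -/
noncomputable def stateBlock {n : ℕ} (F Qhat H : Matrix (Fin n) (Fin n) ℝ) (γ T t : ℝ) :
    Matrix (Fin n) (Fin n) ℝ :=
  (NormedSpace.exp ((t - T) • hamiltonianMatrix F Qhat H γ)).toBlocks₁₁

/-- The costate block `Y` of the solution `(X, Y) = exp ((t - T) 𝒜) (I, 0)` of the Hamiltonian
system. -/
noncomputable def costateBlock {n : ℕ} (F Qhat H : Matrix (Fin n) (Fin n) ℝ) (γ T t : ℝ) :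
    Matrix (Fin n) (Fin n) ℝ :=
  (NormedSpace.exp ((t - T) • hamiltonianMatrix F Qhat H γ)).toBlocks₂₁

section blocks
variable {n : ℕ} (F Qhat H : Matrix (Fin n) (Fin n) ℝ) (γ T : ℝ)

theorem stateBlock_self : stateBlock F Qhat H γ T T = 1 := by
  simp [stateBlock, ← Matrix.fromBlocks_one]

theorem costateBlock_self : costateBlock F Qhat H γ T T = 0 := by
  simp [costateBlock, ← Matrix.fromBlocks_one]

/-- At time T − t the exponent (T − t) − T is −t, so X(T − t) is the upper left block of the inverse
flow, which the symplectic symmetry matches with the lower right block of the flow. -/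
theorem det_zeroOneRow_exp (hQ : Qhat.transpose = Qhat) (hH : H.transpose = H) (t : ℝ) :
    (zeroOneRow n * NormedSpace.exp (t • hamiltonianMatrix F Qhat H γ)
      * (zeroOneRow n).transpose).det = (stateBlock F Qhat H γ T (T - t)).det := by
  rw [zeroOneRow_mul_mul_transpose, stateBlock, sub_sub_cancel_left,
    exp_neg_hamiltonianMatrix_toBlocks₁₁ hQ hH, Matrix.det_transpose]

open scoped Matrix.Norms.L2Operator in
theorem hasDerivAt_stateBlock (t : ℝ) :
    HasDerivAt (stateBlock F Qhat H γ T)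
      ((F + γ • H) * stateBlock F Qhat H γ T t - γ • costateBlock F Qhat H γ T t) t := by
  have h := hasDerivAt_exp_sub_smul (hamiltonianMatrix F Qhat H γ) T t
  let B : Matrix (Fin n ⊕ Fin n) (Fin n ⊕ Fin n) ℝ →ₗ[ℝ] Matrix (Fin n) (Fin n) ℝ :=
    { toFun := Matrix.toBlocks₁₁, map_add' := fun _ _ => rfl, map_smul' := fun _ _ => rfl }
  have h' := B.toContinuousLinearMap.hasFDerivAt.comp_hasDerivAt t h
  convert! h' using 1
  rw [LinearMap.coe_toContinuousLinearMap']
  change _ = Matrix.toBlocks₁₁ (_ * _)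
  rw [stateBlock, costateBlock]
  generalize NormedSpace.exp ((t - T) • hamiltonianMatrix F Qhat H γ) = E
  conv_rhs => rw [← Matrix.fromBlocks_toBlocks E]
  rw [hamiltonianMatrix, Matrix.fromBlocks_multiply, Matrix.toBlocks_fromBlocks₁₁]
  simp [sub_eq_add_neg]

open scoped Matrix.Norms.L2Operator in
theorem hasDerivAt_costateBlock (t : ℝ) :
    HasDerivAt (costateBlock F Qhat H γ T)
      ((γ • H ^ 2 + Qhat + F.transpose * H + H * F) * stateBlock F Qhat H γ T t
        - (F + γ • H).transpose * costateBlock F Qhat H γ T t) t := by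
  have h := hasDerivAt_exp_sub_smul (hamiltonianMatrix F Qhat H γ) T t
  let B : Matrix (Fin n ⊕ Fin n) (Fin n ⊕ Fin n) ℝ →ₗ[ℝ] Matrix (Fin n) (Fin n) ℝ :=
    { toFun := Matrix.toBlocks₂₁, map_add' := fun _ _ => rfl, map_smul' := fun _ _ => rfl }
  have h' := B.toContinuousLinearMap.hasFDerivAt.comp_hasDerivAt t h
  convert! h' using 1
  rw [LinearMap.coe_toContinuousLinearMap']
  change _ = Matrix.toBlocks₂₁ (_ * _)
  rw [stateBlock, costateBlock]
  generalize NormedSpace.exp ((t - T) • hamiltonianMatrix F Qhat H γ) = E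
  conv_rhs => rw [← Matrix.fromBlocks_toBlocks E]
  rw [hamiltonianMatrix, Matrix.fromBlocks_multiply, Matrix.toBlocks_fromBlocks₂₁]
  rw [neg_mul, ← sub_eq_add_neg]

end blocks

/-! ### Calculus of matrix-valued functions. -/

section matrix_derivatives
open scoped Matrix.Norms.L2Operator
variable {m : Type*} [Fintype m] [DecidableEq m]

/-- Links the entrywise derivatives in `IsRiccatiSolution` to calculus in the operator norm. -/
theorem hasDerivWithinAt_matrix_iff {P : ℝ → Matrix m m ℝ} {P' : Matrix m m ℝ} {s : Set ℝ} {t : ℝ} :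
    HasDerivWithinAt P P' s t ↔
      ∀ i j, HasDerivWithinAt (fun u => P u i j) (P' i j) s t := by
  constructor
  · intro h i j
    let B : Matrix m m ℝ →ₗ[ℝ] ℝ := Matrix.entryLinearMap ℝ ℝ i j
    exact B.toContinuousLinearMap.hasFDerivAt.comp_hasDerivWithinAt t h
  · intro h
    have key : HasDerivWithinAt (fun u => ∑ i, ∑ j, P u i j • Matrix.single i j (1 : ℝ))
        (∑ i, ∑ j, P' i j • Matrix.single i j (1 : ℝ)) s t :=
      HasDerivWithinAt.fun_sum fun i _ => HasDerivWithinAt.fun_sum fun j _ => (h i j).smul_const _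
    have e (M : Matrix m m ℝ) : ∑ i, ∑ j, M i j • Matrix.single i j (1 : ℝ) = M := by
      conv_rhs => rw [Matrix.matrix_eq_sum_single M]
      simp
    simpa only [e] using key

theorem HasDerivWithinAt.matrix_transpose {P : ℝ → Matrix m m ℝ} {P' : Matrix m m ℝ} {s : Set ℝ}
    {t : ℝ} (h : HasDerivWithinAt P P' s t) :
    HasDerivWithinAt (fun u => (P u).transpose) P'.transpose s t :=
  hasDerivWithinAt_matrix_iff.2 fun i j => hasDerivWithinAt_matrix_iff.1 h j i

theorem HasDerivAt.matrix_inv {X : ℝ → Matrix m m ℝ} {X' : Matrix m m ℝ} {t : ℝ}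
    (h : HasDerivAt X X' t) (hdet : (X t).det ≠ 0) :
    HasDerivAt (fun u => (X u)⁻¹) (-((X t)⁻¹ * X' * (X t)⁻¹)) t := by
  obtain ⟨U, hU⟩ := (Matrix.isUnit_iff_isUnit_det (X t)).2 (isUnit_iff_ne_zero.2 hdet)
  have h1 := hasFDerivAt_ringInverse (𝕜 := ℝ) U
  rw [hU] at h1
  have h2 := h1.comp_hasDerivAt t h
  have e : (fun u => (X u)⁻¹) = Ring.inverse ∘ X := by
    funext u; exact Matrix.nonsing_inv_eq_ringInverse (X u)
  rw [e]
  convert! h2 using 1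
  simp [← hU, Matrix.coe_units_inv]

end matrix_derivatives

/-! ### The Riccati equation: uniqueness, symmetry, construction from the flow. -/

section riccati
variable {n : ℕ} {F Qhat H : Matrix (Fin n) (Fin n) ℝ} {γ T : ℝ}

open scoped Matrix.Norms.L2Operator in
theorem isRiccatiSolution_iff {P : ℝ → Matrix (Fin n) (Fin n) ℝ} :
    IsRiccatiSolution F Qhat H γ T P ↔
      (∀ t ∈ Icc 0 T, HasDerivWithinAt P
        (γ • P t ^ 2 + Qhat - F.transpose * P t - P t * F) (Icc 0 T) t) ∧ P T = -H := by
  refine and_congr_left fun _ => ⟨?_, fun h => ⟨_, fun t ht =>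
    ⟨hasDerivWithinAt_matrix_iff.1 (h t ht), by abel⟩⟩⟩
  rintro ⟨P', h⟩ t ht
  have e : γ • P t ^ 2 + Qhat - F.transpose * P t - P t * F = P' t := by
    rw [← sub_eq_zero, ← neg_eq_zero, ← (h t ht).2]; abel
  rw [e]
  exact hasDerivWithinAt_matrix_iff.2 (h t ht).1

open scoped Matrix.Norms.L2Operator in
theorem IsRiccatiSolution.continuousOn {P : ℝ → Matrix (Fin n) (Fin n) ℝ}
    (hP : IsRiccatiSolution F Qhat H γ T P) : ContinuousOn P (Icc 0 T) :=
  fun t ht => ((isRiccatiSolution_iff.1 hP).1 t ht).continuousWithinAt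

-- Two solutions are bounded on the compact interval, and there the quadratic right-hand side is
-- Lipschitz. Since the data sit at T, Grönwall is applied in the reversed time T − s.
open scoped Matrix.Norms.L2Operator in
theorem IsRiccatiSolution.eqOn {P R : ℝ → Matrix (Fin n) (Fin n) ℝ}
    (hP : IsRiccatiSolution F Qhat H γ T P) (hR : IsRiccatiSolution F Qhat H γ T R) :
    EqOn P R (Icc 0 T) := by
  obtain ⟨K₁, hK₁⟩ := isCompact_Icc.exists_bound_of_continuousOn hP.continuousOn
  obtain ⟨K₂, hK₂⟩ := isCompact_Icc.exists_bound_of_continuousOn hR.continuousOn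
  have hcP := hP.continuousOn
  have hcR := hR.continuousOn
  rw [isRiccatiSolution_iff] at hP hR
  have hmem : ∀ s ∈ Icc 0 T, T - s ∈ Icc 0 T := fun s hs => ⟨by linarith [hs.2], by linarith [hs.1]⟩
  have hmaps : MapsTo (fun s => T - s) (Icc 0 T) (Icc 0 T) := hmem
  have hder : ∀ s ∈ Icc 0 T, HasDerivWithinAt (fun s => P (T - s) - R (T - s))
      (-((γ • P (T - s) ^ 2 + Qhat - F.transpose * P (T - s) - P (T - s) * F)
        - (γ • R (T - s) ^ 2 + Qhat - F.transpose * R (T - s) - R (T - s) * F)))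
      (Icc 0 T) s := by
    intro s hs
    have h1 : HasDerivWithinAt (fun s => T - s) (-1) (Icc 0 T) s :=
      ((hasDerivAt_id s).const_sub T).hasDerivWithinAt
    have := ((hP.1 _ (hmem s hs)).sub (hR.1 _ (hmem s hs))).scomp s h1 hmaps
    simpa [Function.comp_def] using this
  -- The term |γ|(K₁ + K₂) comes from p² − r² = p(p − r) + (p − r)r.
  have h0 := eq_zero_of_abs_deriv_le_mul_abs_self_of_eq_zero_right (a := 0) (b := T)
    (K := |γ| * (K₁ + K₂) + ‖F.transpose‖ + ‖F‖)
    (fun s hs => (hder s hs).continuousWithinAt)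
    (fun s hs => ((hder s (Ico_subset_Icc_self hs)).mono_of_mem_nhdsWithin
      (Icc_mem_nhdsGE_of_mem hs)))
    (by simp [hP.2, hR.2])
    (by
      intro s hs
      have hs' := hmem s (Ico_subset_Icc_self hs)
      have b₁ := hK₁ _ hs'
      have b₂ := hK₂ _ hs'
      set p := P (T - s)
      set r := R (T - s)
      have e : -((γ • p ^ 2 + Qhat - F.transpose * p - p * F)
          - (γ • r ^ 2 + Qhat - F.transpose * r - r * F)) =
          -(γ • (p * (p - r) + (p - r) * r)) + F.transpose * (p - r) + (p - r) * F := by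
        have : p * (p - r) + (p - r) * r = p ^ 2 - r ^ 2 := by noncomm_ring
        rw [this, smul_sub]
        noncomm_ring
      rw [e]
      set d := p - r
      have n1 : ‖γ • (p * d + d * r)‖ ≤ |γ| * (K₁ * ‖d‖ + ‖d‖ * K₂) := by
        rw [norm_smul, Real.norm_eq_abs]
        gcongr
        refine (norm_add_le _ _).trans (add_le_add ((norm_mul_le _ _).trans ?_)
          ((norm_mul_le _ _).trans ?_)) <;> gcongr
      have n2 := norm_mul_le F.transpose d
      have n3 := norm_mul_le d F
      have n4 := norm_add₃_le (a := -(γ • (p * d + d * r))) (b := F.transpose * d) (c := d * F)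
      rw [norm_neg] at n4
      nlinarith)
  intro t ht
  have := h0 (T - t) (hmem t ht)
  simpa [sub_eq_zero] using this

theorem IsRiccatiSolution.transpose {P : ℝ → Matrix (Fin n) (Fin n) ℝ}
    (hQ : Qhat.transpose = Qhat) (hH : H.transpose = H)
    (hP : IsRiccatiSolution F Qhat H γ T P) :
    IsRiccatiSolution F Qhat H γ T (fun t => (P t).transpose) := by
  rw [isRiccatiSolution_iff] at hP ⊢
  refine ⟨fun t ht => ?_, by simp [hP.2, hH]⟩
  convert! (hP.1 t ht).matrix_transpose using 1
  simp [hQ, Matrix.transpose_pow]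
  abel

-- The classical linearisation: p = Y − HX is the original costate, and P = pX⁻¹ is the feedback
-- matrix.
open scoped Matrix.Norms.L2Operator in
theorem isRiccatiSolution_of_det_stateBlock_ne_zero (hH : H.transpose = H)
    (hdet : ∀ t ∈ Icc 0 T, (stateBlock F Qhat H γ T t).det ≠ 0) :
    IsRiccatiSolution F Qhat H γ T
      (fun t => costateBlock F Qhat H γ T t * (stateBlock F Qhat H γ T t)⁻¹ - H) := by
  rw [isRiccatiSolution_iff]
  refine ⟨fun t ht => ?_, by simp [costateBlock_self]⟩
  have hX := hasDerivAt_stateBlock F Qhat H γ T t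
  have hY := hasDerivAt_costateBlock F Qhat H γ T t
  have h := ((hY.mul (hX.matrix_inv (hdet t ht))).sub_const H).hasDerivWithinAt (s := Icc 0 T)
  convert! h using 1
  have hu : stateBlock F Qhat H γ T t * (stateBlock F Qhat H γ T t)⁻¹ = 1 :=
    Matrix.mul_nonsing_inv _ (isUnit_iff_ne_zero.2 (hdet t ht))
  generalize stateBlock F Qhat H γ T t = X at *
  generalize costateBlock F Qhat H γ T t = Y at *
  have e1 : (γ • H ^ 2 + Qhat + F.transpose * H + H * F) * X * X⁻¹ =
      γ • H ^ 2 + Qhat + F.transpose * H + H * F := by rw [mul_assoc, hu, mul_one]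
  have e2 : Y * X⁻¹ * (F + γ • H) * X * X⁻¹ = Y * X⁻¹ * (F + γ • H) := by
    rw [mul_assoc (Y * X⁻¹ * (F + γ • H)), hu, mul_one]
  have e3 : Y * -(X⁻¹ * ((F + γ • H) * X - γ • Y) * X⁻¹) =
      γ • (Y * X⁻¹ * (Y * X⁻¹)) - Y * X⁻¹ * (F + γ • H) * X * X⁻¹ := by
    simp only [mul_sub, sub_mul, smul_mul_assoc, mul_smul_comm, mul_assoc, neg_sub]
  rw [sub_mul _ _ X⁻¹, e1, e3, e2, mul_assoc _ Y, Matrix.transpose_add, Matrix.transpose_smul, hH]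
  generalize Y * X⁻¹ = W
  simp only [mul_add, add_mul, mul_sub, sub_mul, pow_two, smul_mul_assoc, mul_smul_comm, smul_sub]
  abel

end riccati

/-! ### Absolute continuity, Grönwall and Cauchy–Schwarz for integral equations. -/

section integral_equations
variable {E : Type*} [NormedAddCommGroup E]

theorem AbsolutelyContinuousOnInterval.of_dist_le {X Y : Type*} [PseudoMetricSpace X]
    [PseudoMetricSpace Y] {f : ℝ → X} {G : ℝ → Y} {a b C : ℝ}
    (hG : AbsolutelyContinuousOnInterval G a b)
    (h : ∀ x ∈ uIcc a b, ∀ y ∈ uIcc a b, dist (f x) (f y) ≤ C * dist (G x) (G y)) :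
    AbsolutelyContinuousOnInterval f a b := by
  have hG' := Filter.Tendsto.const_mul C hG
  rw [mul_zero] at hG'
  refine squeeze_zero' (Filter.Eventually.of_forall fun I =>
    Finset.sum_nonneg fun i _ => dist_nonneg) ?_ hG'
  refine Filter.eventually_inf_principal.2 (Filter.Eventually.of_forall fun I hI => ?_)
  rw [Finset.mul_sum]
  exact Finset.sum_le_sum fun i hi => h _ (hI.1 i hi).1 _ (hI.1 i hi).2

/-- Grönwall's inequality in integrated form. -/
theorem le_mul_exp_of_le_mul_integral_add {φ : ℝ → ℝ} {K δ T : ℝ} (hK : 0 < K) (hT : 0 ≤ T)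
    (hδ : 0 ≤ δ) (hφ : ContinuousOn φ (Icc 0 T)) (hφ0 : ∀ t ∈ Icc 0 T, 0 ≤ φ t)
    (h : ∀ t ∈ Icc 0 T, φ t ≤ K * (∫ s in (0 : ℝ)..t, φ s) + δ) :
    ∀ t ∈ Icc 0 T, φ t ≤ δ * Real.exp (K * T) := by
  -- A continuous extension to the whole line has a primitive differentiable everywhere. The
  -- differential Grönwall inequality is applied to that primitive.
  set ψ : ℝ → ℝ := IccExtend hT (domRestrict (Icc 0 T) φ)
  have hψc : Continuous ψ := (continuousOn_iff_continuous_domRestrict.1 hφ).Icc_extend'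
  have hψφ : ∀ t ∈ Icc 0 T, ψ t = φ t := fun t ht => IccExtend_of_mem hT _ ht
  have hint : ∀ t ∈ Icc 0 T, ∫ s in (0 : ℝ)..t, φ s = ∫ s in (0 : ℝ)..t, ψ s := by
    intro t ht
    refine intervalIntegral.integral_congr fun s hs => (hψφ s ?_).symm
    rw [uIcc_of_le ht.1] at hs
    exact ⟨hs.1, hs.2.trans ht.2⟩
  have hder : ∀ t, HasDerivAt (fun t => ∫ s in (0 : ℝ)..t, ψ s) (ψ t) t := fun t =>
    (hψc.integral_hasStrictDerivAt 0 t).hasDerivAt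
  have hnn : ∀ t ∈ Icc 0 T, 0 ≤ ∫ s in (0 : ℝ)..t, ψ s := fun t ht =>
    intervalIntegral.integral_nonneg ht.1 fun s hs => by
      have hs' : s ∈ Icc 0 T := ⟨hs.1, hs.2.trans ht.2⟩
      rw [hψφ s hs']; exact hφ0 s hs'
  have hg := norm_le_gronwallBound_of_norm_deriv_right_le (f := fun t => ∫ s in (0 : ℝ)..t, ψ s)
    (f' := ψ) (a := 0) (b := T) (δ := 0) (K := K) (ε := δ)
    (fun t _ => (hder t).continuousAt.continuousWithinAt)
    (fun t _ => (hder t).hasDerivWithinAt) (by simp)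
    (fun t ht => by
      have ht' := Ico_subset_Icc_self ht
      rw [Real.norm_of_nonneg (hnn t ht'), hψφ t ht', Real.norm_of_nonneg (hφ0 t ht'),
        ← hint t ht']
      exact h t ht')
  intro t ht
  have h1 := hg t ht
  rw [Real.norm_of_nonneg (hnn t ht), ← hint t ht, gronwallBound_of_K_ne_0 hK.ne', sub_zero] at h1
  have h2 := h t ht
  have h3 : K * ∫ s in (0 : ℝ)..t, φ s ≤ δ * (Real.exp (K * t) - 1) := by
    calc _ ≤ K * (0 * Real.exp (K * t) + δ / K * (Real.exp (K * t) - 1)) := by gcongr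
      _ = _ := by field_simp; ring
  have h4 : Real.exp (K * t) ≤ Real.exp (K * T) := by
    have := ht.2
    gcongr
  nlinarith

/-- The variance of f about its mean over [0, T] is nonnegative. -/
theorem sq_integral_le_mul_integral_sq {f : ℝ → ℝ} {T : ℝ} (hT : 0 < T)
    (hf : IntervalIntegrable f volume 0 T) (hf2 : IntervalIntegrable (fun t => f t ^ 2) volume 0 T) :
    (∫ t in (0 : ℝ)..T, f t) ^ 2 ≤ T * ∫ t in (0 : ℝ)..T, f t ^ 2 := by
  set I := ∫ t in (0 : ℝ)..T, f t with hI
  have h0 : 0 ≤ ∫ t in (0 : ℝ)..T, (f t - I / T) ^ 2 :=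
    intervalIntegral.integral_nonneg hT.le fun _ _ => sq_nonneg _
  have e : ∫ t in (0 : ℝ)..T, (f t - I / T) ^ 2 =
      (∫ t in (0 : ℝ)..T, f t ^ 2) - 2 * (I / T) * I + T * (I / T) ^ 2 := by
    have : ∀ t, (f t - I / T) ^ 2 = f t ^ 2 - 2 * (I / T) * f t + (I / T) ^ 2 := fun t => by ring
    simp_rw [this]
    rw [intervalIntegral.integral_add (hf2.sub (hf.const_mul _)) (by simp),
      intervalIntegral.integral_sub hf2 (hf.const_mul _), intervalIntegral.integral_const_mul]
    simp [hI]
  rw [e] at h0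
  have : T * ((∫ t in (0 : ℝ)..T, f t ^ 2) - 2 * (I / T) * I + T * (I / T) ^ 2) =
      T * (∫ t in (0 : ℝ)..T, f t ^ 2) - I ^ 2 := by field_simp; ring
  nlinarith

variable [InnerProductSpace ℝ E]

theorem integral_deriv_eq_sub_of_ae_hasDerivAt {φ ψ : ℝ → ℝ} {T : ℝ} (hT : 0 ≤ T)
    (hφ : AbsolutelyContinuousOnInterval φ 0 T)
    (h : ∀ᵐ t, t ∈ Ioo 0 T → HasDerivAt φ (ψ t) t) :
    ∫ t in (0 : ℝ)..T, ψ t = φ T - φ 0 := by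
  rw [← hφ.integral_deriv_eq_sub]
  refine intervalIntegral.integral_congr_ae ?_
  have hne : ∀ᵐ t : ℝ, t ≠ T := by simp [ae_iff]
  filter_upwards [h, hne] with t ht htT hmem
  rw [uIoc_of_le hT] at hmem
  exact (ht ⟨hmem.1, lt_of_le_of_ne hmem.2 htT⟩).deriv.symm

/-- Integrated product rule for the quadratic form `⟪z, P z⟫` along a state `z` that is only
absolutely continuous. -/
theorem integral_inner_clm_apply [CompleteSpace E] {z h : ℝ → E} {P P' : ℝ → E →L[ℝ] E}
    {T : ℝ} (hT : 0 ≤ T) (hh : IntervalIntegrable h volume 0 T) (hzc : ContinuousOn z (Icc 0 T))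
    (hz : ∀ t ∈ Icc 0 T, z t = ∫ s in (0 : ℝ)..t, h s)
    (hP : ∀ t ∈ Icc 0 T, HasDerivWithinAt P (P' t) (Icc 0 T) t) (hP' : ContinuousOn P' (Icc 0 T)) :
    ∫ t in (0 : ℝ)..T, (inner ℝ (z t) (P' t (z t) + P t (h t)) + inner ℝ (h t) (P t (z t))) =
      inner ℝ (z T) (P T (z T)) := by
  have h0 : (0 : ℝ) ∈ Icc 0 T := ⟨le_rfl, hT⟩
  have hsub : ∀ {u v}, u ∈ Icc 0 T → v ∈ Icc 0 T → uIcc u v ⊆ uIcc 0 T := fun hu hv => by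
    rw [uIcc_of_le hT]; exact uIcc_subset_Icc hu hv
  -- The primitive G of ‖h‖ + 1 dominates both increments: ‖h‖ controls z, and the summand 1
  -- controls the Lipschitz map P. Hence ⟪z, Pz⟫ inherits absolute continuity from G.
  have hh' : IntervalIntegrable (fun s => ‖h s‖ + 1) volume 0 T := hh.norm.add (by simp)
  set G : ℝ → ℝ := fun x => ∫ s in (0 : ℝ)..x, (‖h s‖ + 1) with hG
  have hGac : AbsolutelyContinuousOnInterval G 0 T :=
    hh'.absolutelyContinuousOnInterval_intervalIntegral (by simp)
  have hGsub : ∀ x ∈ Icc 0 T, ∀ y ∈ Icc 0 T, G y - G x = (∫ s in x..y, ‖h s‖) + (y - x) := by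
    intro x hx y hy
    rw [hG, intervalIntegral.integral_interval_sub_left (hh'.mono_set (hsub h0 hy))
      (hh'.mono_set (hsub h0 hx)), intervalIntegral.integral_add
      (hh.norm.mono_set (hsub hx hy)) (by simp)]
    simp
  obtain ⟨B₁, hB₁⟩ := isCompact_Icc.exists_bound_of_continuousOn hzc
  obtain ⟨B₂, hB₂⟩ := isCompact_Icc.exists_bound_of_continuousOn
    fun t ht => (hP t ht).continuousWithinAt
  obtain ⟨B₃, hB₃⟩ := isCompact_Icc.exists_bound_of_continuousOn hP'
  have hB₁0 : 0 ≤ B₁ := (norm_nonneg _).trans (hB₁ 0 h0)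
  have hB₂0 : 0 ≤ B₂ := (norm_nonneg _).trans (hB₂ 0 h0)
  have hB₃0 : 0 ≤ B₃ := (norm_nonneg _).trans (hB₃ 0 h0)
  have hac : AbsolutelyContinuousOnInterval (fun t => inner ℝ (z t) (P t (z t))) 0 T := by
    refine hGac.of_dist_le (C := 2 * (B₁ * B₂) + B₁ * B₃ * B₁) ?_
    rw [uIcc_of_le hT]
    suffices key : ∀ x ∈ Icc 0 T, ∀ y ∈ Icc 0 T, x ≤ y →
        dist (inner ℝ (z x) (P x (z x))) (inner ℝ (z y) (P y (z y))) ≤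
          (2 * (B₁ * B₂) + B₁ * B₃ * B₁) * dist (G x) (G y) by
      intro x hx y hy
      rcases le_total x y with hxy | hxy
      · exact key x hx y hy hxy
      · rw [dist_comm, dist_comm (G x)]
        exact key y hy x hx hxy
    intro x hx y hy hxy
    have hint : 0 ≤ ∫ s in x..y, ‖h s‖ :=
      intervalIntegral.integral_nonneg hxy fun _ _ => norm_nonneg _
    have hGd := hGsub x hx y hy
    have d1 : ‖z y - z x‖ ≤ G y - G x := by
      rw [hz x hx, hz y hy, intervalIntegral.integral_interval_sub_left
        (hh.mono_set (hsub h0 hy)) (hh.mono_set (hsub h0 hx))]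
      linarith [intervalIntegral.norm_integral_le_integral_norm (f := h) (μ := volume) hxy]
    have d2 : ‖P y - P x‖ ≤ B₃ * (G y - G x) := by
      have := (convex_Icc 0 T).norm_image_sub_le_of_norm_hasDerivWithin_le hP hB₃ hx hy
      rw [Real.norm_of_nonneg (sub_nonneg.2 hxy)] at this
      exact this.trans (mul_le_mul_of_nonneg_left (by linarith) hB₃0)
    have e : inner ℝ (z y) (P y (z y)) - inner ℝ (z x) (P x (z x)) =
        inner ℝ (z y - z x) (P y (z y)) + inner ℝ (z x) ((P y - P x) (z y))
          + inner ℝ (z x) (P x (z y - z x)) := by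
      simp only [inner_sub_left, inner_sub_right, sub_apply, map_sub]
      ring
    have hGnn : 0 ≤ G y - G x := (norm_nonneg _).trans d1
    have zx := hB₁ x hx
    have zy := hB₁ y hy
    have px := hB₂ x hx
    have py := hB₂ y hy
    rw [dist_comm, dist_comm (G x), Real.dist_eq, Real.dist_eq, abs_of_nonneg hGnn, e]
    have t1 : |inner ℝ (z y - z x) (P y (z y))| ≤ (G y - G x) * (B₂ * B₁) :=
      (abs_real_inner_le_norm _ _).trans (mul_le_mul d1
        (((P y).le_opNorm _).trans (by gcongr)) (norm_nonneg _) hGnn)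
    have t2 : |inner ℝ (z x) ((P y - P x) (z y))| ≤ B₁ * (B₃ * (G y - G x) * B₁) :=
      (abs_real_inner_le_norm _ _).trans (mul_le_mul zx
        (((P y - P x).le_opNorm _).trans (by gcongr)) (norm_nonneg _) hB₁0)
    have t3 : |inner ℝ (z x) (P x (z y - z x))| ≤ B₁ * (B₂ * (G y - G x)) :=
      (abs_real_inner_le_norm _ _).trans (mul_le_mul zx
        (((P x).le_opNorm _).trans (by gcongr)) (norm_nonneg _) hB₁0)
    calc _ ≤ _ := abs_add_three _ _ _
      _ ≤ _ := add_le_add (add_le_add t1 t2) t3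
      _ = _ := by ring
  have hz0 : z 0 = 0 := by simpa using hz 0 h0
  rw [integral_deriv_eq_sub_of_ae_hasDerivAt hT hac, hz0, inner_zero_left, sub_zero]
  filter_upwards [hh.ae_hasDerivAt_integral] with t ht hmem
  have htIcc := Ioo_subset_Icc_self hmem
  have hnhds : Icc 0 T ∈ nhds t := Icc_mem_nhds hmem.1 hmem.2
  have hzd : HasDerivAt z (h t) t :=
    (ht (by rwa [uIcc_of_le hT]) 0 (by simp)).congr_of_eventuallyEq
      (Filter.eventually_of_mem hnhds hz)
  exact hzd.inner ℝ (((hP t htIcc).hasDerivAt hnhds).clm_apply hzd)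

end integral_equations

/-! ### Completing the square and coercivity. -/

section euclidean
variable {n : ℕ}

theorem toEuclideanCLM_mul_apply (M N : Matrix (Fin n) (Fin n) ℝ) (x : EuclideanSpace ℝ (Fin n)) :
    Matrix.toEuclideanCLM (𝕜 := ℝ) (M * N) x =
      Matrix.toEuclideanCLM (𝕜 := ℝ) M (Matrix.toEuclideanCLM (𝕜 := ℝ) N x) := by
  rw [map_mul]; rfl

theorem inner_toEuclideanCLM_transpose (M : Matrix (Fin n) (Fin n) ℝ)
    (x y : EuclideanSpace ℝ (Fin n)) :
    inner ℝ x (Matrix.toEuclideanCLM (𝕜 := ℝ) M.transpose y) =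
      inner ℝ (Matrix.toEuclideanCLM (𝕜 := ℝ) M x) y := by
  have h : Matrix.toEuclideanCLM (𝕜 := ℝ) M.transpose =
      ContinuousLinearMap.adjoint (Matrix.toEuclideanCLM (𝕜 := ℝ) M) := by
    rw [← Matrix.conjTranspose_eq_transpose_of_trivial, ← Matrix.star_eq_conjTranspose, map_star,
      ContinuousLinearMap.star_eq_adjoint]
  rw [h, ContinuousLinearMap.adjoint_inner_right]

open scoped Matrix.Norms.L2Operator in
theorem HasDerivWithinAt.toEuclideanCLM {P : ℝ → Matrix (Fin n) (Fin n) ℝ}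
    {P' : Matrix (Fin n) (Fin n) ℝ} {s : Set ℝ} {t : ℝ} (h : HasDerivWithinAt P P' s t) :
    HasDerivWithinAt (fun u => Matrix.toEuclideanCLM (𝕜 := ℝ) (P u))
      (Matrix.toEuclideanCLM (𝕜 := ℝ) P') s t := by
  let B : Matrix (Fin n) (Fin n) ℝ →ₗ[ℝ]
      (EuclideanSpace ℝ (Fin n) →L[ℝ] EuclideanSpace ℝ (Fin n)) :=
    (Matrix.toEuclideanCLM (𝕜 := ℝ) (n := Fin n)).toAlgEquiv.toLinearMap
  exact B.toContinuousLinearMap.hasFDerivAt.comp_hasDerivWithinAt t h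

open scoped Matrix.Norms.L2Operator in
theorem ContinuousOn.toEuclideanCLM {P : ℝ → Matrix (Fin n) (Fin n) ℝ} {s : Set ℝ}
    (h : ContinuousOn P s) : ContinuousOn (fun u => Matrix.toEuclideanCLM (𝕜 := ℝ) (P u)) s := by
  let B : Matrix (Fin n) (Fin n) ℝ →ₗ[ℝ]
      (EuclideanSpace ℝ (Fin n) →L[ℝ] EuclideanSpace ℝ (Fin n)) :=
    (Matrix.toEuclideanCLM (𝕜 := ℝ) (n := Fin n)).toAlgEquiv.toLinearMap
  exact B.toContinuousLinearMap.continuous.comp_continuousOn h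

theorem ContinuousOn.memLp_two_Icc {E : Type*} [NormedAddCommGroup E] {f : ℝ → E} {a b : ℝ}
    (hf : ContinuousOn f (Icc a b)) : MemLp f 2 (volume.restrict (Icc a b)) := by
  obtain ⟨C, hC⟩ := isCompact_Icc.exists_bound_of_continuousOn hf
  exact MemLp.of_bound (hf.aestronglyMeasurable_of_isCompact isCompact_Icc measurableSet_Icc) C
    ((ae_restrict_iff' measurableSet_Icc).2 (Filter.Eventually.of_forall hC))

theorem MeasureTheory.MemLp.intervalIntegrable_Icc {E : Type*} [NormedAddCommGroup E] {f : ℝ → E}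
    {T : ℝ} (hT : 0 ≤ T) (hf : MemLp f 2 (volume.restrict (Icc 0 T))) :
    IntervalIntegrable f volume 0 T := by
  rw [intervalIntegrable_iff_integrableOn_Icc_of_le hT]
  exact hf.integrable (by norm_num)

theorem MeasureTheory.MemLp.intervalIntegrable_norm_sq_Icc {E : Type*} [NormedAddCommGroup E]
    {f : ℝ → E} {T : ℝ} (hT : 0 ≤ T) (hf : MemLp f 2 (volume.restrict (Icc 0 T))) :
    IntervalIntegrable (fun t => ‖f t‖ ^ 2) volume 0 T := by
  rw [intervalIntegrable_iff_integrableOn_Icc_of_le hT]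
  exact MemLp.integrable_norm_pow (p := 2) hf two_ne_zero

variable {F Qhat H : Matrix (Fin n) (Fin n) ℝ} {γ T : ℝ}

/-- Integrating d/dt ⟪z, Pz⟫ produces the terminal term through P(T) = −H. The Riccati equation
cancels the terms in F and leaves γ|Pz|², which completes the square; symmetry of P merges the two
cross terms with g. -/
theorem IsRiccatiSolution.auxCost_eq {P : ℝ → Matrix (Fin n) (Fin n) ℝ} (hγ : 0 < γ) (hT : 0 ≤ T)
    (hsymm : ∀ t ∈ Icc 0 T, (P t).transpose = P t) (hP : IsRiccatiSolution F Qhat H γ T P)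
    {g z : ℝ → EuclideanSpace ℝ (Fin n)} (hg : MemLp g 2 (volume.restrict (Icc 0 T)))
    (hz : IsState F T g z) :
    auxCost Qhat H γ T g z =
      1 / γ * ∫ t in (0 : ℝ)..T, ‖g t + γ • Matrix.toEuclideanCLM (𝕜 := ℝ) (P t) (z t)‖ ^ 2 := by
  have hPc := hP.continuousOn
  obtain ⟨hzc, hzi⟩ := hz
  have hFz : ContinuousOn (fun t => Matrix.toEuclideanCLM (𝕜 := ℝ) F (z t)) (Icc 0 T) :=
    (ContinuousLinearMap.continuous _).comp_continuousOn hzc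
  have hPz : ContinuousOn (fun t => γ • Matrix.toEuclideanCLM (𝕜 := ℝ) (P t) (z t)) (Icc 0 T) :=
    (hPc.toEuclideanCLM.clm_apply hzc).const_smul γ
  have hQz : ContinuousOn (fun t => inner ℝ (z t) (Matrix.toEuclideanCLM (𝕜 := ℝ) Qhat (z t)))
      (Icc 0 T) := hzc.inner ((ContinuousLinearMap.continuous _).comp_continuousOn hzc)
  have iQ := (ContinuousOn.intervalIntegrable (μ := volume) (by rwa [uIcc_of_le hT]) :
    IntervalIntegrable (fun t => inner ℝ (z t) (Matrix.toEuclideanCLM (𝕜 := ℝ) Qhat (z t)))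
      volume 0 T)
  have ig := hg.intervalIntegrable_norm_sq_Icc hT
  have iu : IntervalIntegrable
      (fun t => ‖g t + γ • Matrix.toEuclideanCLM (𝕜 := ℝ) (P t) (z t)‖ ^ 2) volume 0 T :=
    (hg.add hPz.memLp_two_Icc).intervalIntegrable_norm_sq_Icc hT
  have hP2 := (isRiccatiSolution_iff.1 hP).2
  have key := integral_inner_clm_apply (P := fun t => Matrix.toEuclideanCLM (𝕜 := ℝ) (P t))
    (h := fun t => Matrix.toEuclideanCLM (𝕜 := ℝ) F (z t) + g t) hT
    ((hFz.memLp_two_Icc.add hg).intervalIntegrable_Icc hT) hzc hzi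
    (fun t ht => ((isRiccatiSolution_iff.1 hP).1 t ht).toEuclideanCLM)
    (ContinuousOn.toEuclideanCLM (by fun_prop))
  have e : ∀ t ∈ uIcc 0 T,
      inner ℝ (z t) (Matrix.toEuclideanCLM (𝕜 := ℝ)
          (γ • P t ^ 2 + Qhat - F.transpose * P t - P t * F) (z t)
        + Matrix.toEuclideanCLM (𝕜 := ℝ) (P t) (Matrix.toEuclideanCLM (𝕜 := ℝ) F (z t) + g t))
        + inner ℝ (Matrix.toEuclideanCLM (𝕜 := ℝ) F (z t) + g t)
          (Matrix.toEuclideanCLM (𝕜 := ℝ) (P t) (z t)) =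
      inner ℝ (z t) (Matrix.toEuclideanCLM (𝕜 := ℝ) Qhat (z t)) +
        1 / γ * ‖g t + γ • Matrix.toEuclideanCLM (𝕜 := ℝ) (P t) (z t)‖ ^ 2
        - 1 / γ * ‖g t‖ ^ 2 := by
    intro t ht
    rw [uIcc_of_le hT] at ht
    have hs := inner_toEuclideanCLM_transpose (P t) (z t)
    rw [hsymm t ht] at hs
    simp only [map_add, map_sub, map_smul, add_apply, sub_apply, smul_apply, pow_two,
      toEuclideanCLM_mul_apply, inner_add_left, inner_add_right, inner_sub_right, inner_smul_right,
      inner_toEuclideanCLM_transpose, hs]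
    rw [← pow_two, ← pow_two, norm_add_sq_real, norm_smul, inner_smul_right, Real.norm_eq_abs,
      mul_pow, sq_abs, real_inner_self_eq_norm_sq,
      real_inner_comm (g t) (Matrix.toEuclideanCLM (𝕜 := ℝ) (P t) (z t))]
    field_simp
    ring
  rw [intervalIntegral.integral_congr e, intervalIntegral.integral_sub
    (iQ.add (iu.const_mul _)) (ig.const_mul _), intervalIntegral.integral_add iQ (iu.const_mul _),
    intervalIntegral.integral_const_mul, intervalIntegral.integral_const_mul, hP2, map_neg,
    neg_apply, inner_neg_right] at key
  have iQ' : IntervalIntegrable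
      (fun t => -inner ℝ (z t) (Matrix.toEuclideanCLM (𝕜 := ℝ) Qhat (z t))) volume 0 T := iQ.neg
  rw [auxCost, intervalIntegral.integral_add iQ' (ig.const_mul _), intervalIntegral.integral_neg,
    intervalIntegral.integral_const_mul]
  linarith

/-- With u = g + γPz the state obeys the closed loop ż = (F − γP)z + u, so Grönwall bounds z, and
then g = u − γPz, by u in L². -/
theorem IsRiccatiSolution.uniformConvexity {P : ℝ → Matrix (Fin n) (Fin n) ℝ} (hγ : 0 < γ)
    (hT : 0 < T) (hsymm : ∀ t ∈ Icc 0 T, (P t).transpose = P t)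
    (hP : IsRiccatiSolution F Qhat H γ T P) : UniformConvexity F Qhat H γ T := by
  have hPc := hP.continuousOn.toEuclideanCLM.const_smul γ
  have hFPc := (continuousOn_const (c := Matrix.toEuclideanCLM (𝕜 := ℝ) F)).sub hPc
  obtain ⟨N, hN⟩ := isCompact_Icc.exists_bound_of_continuousOn hPc
  obtain ⟨K₀, hK₀⟩ := isCompact_Icc.exists_bound_of_continuousOn hFPc
  -- The maximum with 1 secures the strict positivity that the integrated Grönwall bound requires.
  set K := max K₀ 1
  have hK : 0 < K := lt_max_of_lt_right one_pos
  have hN0 : 0 ≤ N := (norm_nonneg _).trans (hN 0 ⟨le_rfl, hT.le⟩)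
  -- From |g|² ≤ 2|u|² + 2N²|z|² with |z| ≤ δ exp(KT) and δ² ≤ T∫|u|²; the last factor T comes from
  -- integrating a constant.
  set C := 2 + 2 * N ^ 2 * (T * Real.exp (K * T) ^ 2) * T with hC
  have hC0 : 0 < C := by positivity
  refine ⟨1 / (γ * C), by positivity, fun g z hg hz => ?_⟩
  rw [hP.auxCost_eq hγ hT.le hsymm hg hz]
  obtain ⟨hzc, hzi⟩ := hz
  have hPz : ContinuousOn (fun t => γ • Matrix.toEuclideanCLM (𝕜 := ℝ) (P t) (z t)) (Icc 0 T) :=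
    hPc.clm_apply hzc
  set u := fun t => g t + γ • Matrix.toEuclideanCLM (𝕜 := ℝ) (P t) (z t) with hu
  have huL : MemLp u 2 (volume.restrict (Icc 0 T)) := hg.add hPz.memLp_two_Icc
  have iu := (huL.intervalIntegrable_Icc hT.le).norm
  have iu2 := huL.intervalIntegrable_norm_sq_Icc hT.le
  set δ := ∫ t in (0 : ℝ)..T, ‖u t‖
  have hδ2 : δ ^ 2 ≤ T * ∫ t in (0 : ℝ)..T, ‖u t‖ ^ 2 := sq_integral_le_mul_integral_sq hT iu iu2
  have hδ0 : 0 ≤ δ := intervalIntegral.integral_nonneg hT.le fun _ _ => norm_nonneg _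
  have hzb := le_mul_exp_of_le_mul_integral_add (φ := fun t => ‖z t‖) hK hT.le hδ0 hzc.norm
    (fun _ _ => norm_nonneg _) (by
      intro t ht
      have hsub : uIcc 0 t ⊆ uIcc 0 T := by
        rw [uIcc_of_le hT.le, uIcc_of_le ht.1]; exact Icc_subset_Icc_right ht.2
      have iz : IntervalIntegrable (fun s => ‖z s‖) volume 0 t :=
        ContinuousOn.intervalIntegrable
          (hzc.norm.mono (by rwa [uIcc_of_le hT.le] at hsub))
      have iut : IntervalIntegrable (fun s => ‖u s‖) volume 0 t := iu.mono_set hsub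
      rw [hzi t ht]
      calc _ ≤ ∫ s in (0 : ℝ)..t, (K * ‖z s‖ + ‖u s‖) := by
            refine intervalIntegral.norm_integral_le_of_norm_le ht.1
              (Filter.Eventually.of_forall fun s hs => ?_) ((iz.const_mul K).add iut)
            have hs' : s ∈ Icc 0 T := ⟨hs.1.le, hs.2.trans ht.2⟩
            have e : Matrix.toEuclideanCLM (𝕜 := ℝ) F (z s) + g s =
                (Matrix.toEuclideanCLM (𝕜 := ℝ) F - γ • Matrix.toEuclideanCLM (𝕜 := ℝ) (P s)) (z s)
                  + u s := by
              simp only [hu, sub_apply, smul_apply]; abel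
            rw [e]
            refine (norm_add_le _ _).trans (add_le_add_left ?_ _)
            refine (ContinuousLinearMap.le_opNorm _ _).trans ?_
            exact mul_le_mul_of_nonneg_right ((hK₀ s hs').trans (le_max_left _ _)) (norm_nonneg _)
        _ = K * (∫ s in (0 : ℝ)..t, ‖z s‖) + ∫ s in (0 : ℝ)..t, ‖u s‖ := by
            rw [intervalIntegral.integral_add (iz.const_mul K) iut,
              intervalIntegral.integral_const_mul]
        _ ≤ _ := by
            gcongr
            exact intervalIntegral.integral_mono_interval le_rfl ht.1 ht.2
              (Filter.Eventually.of_forall fun _ => norm_nonneg _) iu)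
  have hgb : ∫ t in (0 : ℝ)..T, ‖g t‖ ^ 2 ≤ C * ∫ t in (0 : ℝ)..T, ‖u t‖ ^ 2 := by
    calc ∫ t in (0 : ℝ)..T, ‖g t‖ ^ 2
        ≤ ∫ t in (0 : ℝ)..T, (2 * ‖u t‖ ^ 2 + 2 * N ^ 2 * (δ * Real.exp (K * T)) ^ 2) := by
          refine intervalIntegral.integral_mono_on hT.le (hg.intervalIntegrable_norm_sq_Icc hT.le)
            ((iu2.const_mul 2).add (by simp)) fun t ht => ?_
          have e : g t = u t - (γ • Matrix.toEuclideanCLM (𝕜 := ℝ) (P t)) (z t) := by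
            simp [hu]
          have h1 : ‖(γ • Matrix.toEuclideanCLM (𝕜 := ℝ) (P t)) (z t)‖ ≤
              N * (δ * Real.exp (K * T)) :=
            (ContinuousLinearMap.le_opNorm _ _).trans
              (mul_le_mul (hN t ht) (hzb t ht) (norm_nonneg _) hN0)
          have h2 : ‖g t‖ ≤ ‖u t‖ + N * (δ * Real.exp (K * T)) := by
            rw [e]; exact (norm_sub_le _ _).trans (by gcongr)
          calc ‖g t‖ ^ 2 ≤ (‖u t‖ + N * (δ * Real.exp (K * T))) ^ 2 := by gcongr
            _ ≤ _ := by nlinarith [sq_nonneg (‖u t‖ - N * (δ * Real.exp (K * T)))]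
      _ = 2 * (∫ t in (0 : ℝ)..T, ‖u t‖ ^ 2) + 2 * N ^ 2 * (δ * Real.exp (K * T)) ^ 2 * T := by
          rw [intervalIntegral.integral_add (iu2.const_mul 2) (by simp),
            intervalIntegral.integral_const_mul]
          simp
          ring
      _ = 2 * (∫ t in (0 : ℝ)..T, ‖u t‖ ^ 2) + 2 * N ^ 2 * Real.exp (K * T) ^ 2 * T * δ ^ 2 := by
          ring
      _ ≤ 2 * (∫ t in (0 : ℝ)..T, ‖u t‖ ^ 2) + 2 * N ^ 2 * Real.exp (K * T) ^ 2 * T *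
            (T * ∫ t in (0 : ℝ)..T, ‖u t‖ ^ 2) := by gcongr
      _ = _ := by rw [hC]; ring
  have : 1 / (γ * C) * ∫ t in (0 : ℝ)..T, ‖g t‖ ^ 2 ≤
      1 / γ * ∫ t in (0 : ℝ)..T, ‖u t‖ ^ 2 := by
    calc _ ≤ 1 / (γ * C) * (C * ∫ t in (0 : ℝ)..T, ‖u t‖ ^ 2) := by gcongr
      _ = _ := by field_simp
  linarith

end euclidean

/-! ### Extremals and conjugate points. -/

theorem intervalIntegral_indicator_Ioi {E : Type*} [NormedAddCommGroup E] [NormedSpace ℝ E]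
    (k : ℝ → E) {t₀ t : ℝ} (ht₀ : 0 ≤ t₀) (ht : 0 ≤ t) :
    ∫ s in (0 : ℝ)..t, (Ioi t₀).indicator k s = ∫ s in Ioc t₀ t, k s := by
  rw [intervalIntegral.integral_of_le ht, integral_indicator measurableSet_Ioi,
    Measure.restrict_restrict measurableSet_Ioi]
  congr 2
  ext s
  simp only [mem_inter_iff, mem_Ioi, mem_Ioc]
  exact ⟨fun h => ⟨h.1, h.2.2⟩, fun h => ⟨h.1, ht₀.trans_lt h.1, h.2⟩⟩

section euclidean
variable {n : ℕ} {F Qhat H : Matrix (Fin n) (Fin n) ℝ} {γ T : ℝ}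

/-- Under uniform convexity, an extremal whose state vanishes at some time is trivial: truncated at
that time it has cost zero. -/
theorem UniformConvexity.extremal_eq_zero (hconv : UniformConvexity F Qhat H γ T) (hγ : 0 < γ)
    {z p : ℝ → EuclideanSpace ℝ (Fin n)} {t₀ : ℝ} (ht₀ : t₀ ∈ Icc 0 T)
    (hz : ∀ t, HasDerivAt z (Matrix.toEuclideanCLM (𝕜 := ℝ) F (z t) - γ • p t) t)
    (hp : ∀ t, HasDerivAt p (Matrix.toEuclideanCLM (𝕜 := ℝ) Qhat (z t)
      - Matrix.toEuclideanCLM (𝕜 := ℝ) F.transpose (p t)) t)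
    (hz0 : z t₀ = 0) (hpT : p T = -Matrix.toEuclideanCLM (𝕜 := ℝ) H (z T)) : z T = 0 := by
  obtain ⟨ε, hε, hconv⟩ := hconv
  have hT : 0 ≤ T := ht₀.1.trans ht₀.2
  have hzc : Continuous z := continuous_iff_continuousAt.2 fun t => (hz t).continuousAt
  have hpc : Continuous p := continuous_iff_continuousAt.2 fun t => (hp t).continuousAt
  -- The control is off until t₀ and equals −γp afterwards. Its state stays at 0 until t₀ and then
  -- follows z, with no jump because z(t₀) = 0.
  set g : ℝ → EuclideanSpace ℝ (Fin n) := (Ioi t₀).indicator fun t => -(γ • p t) with hg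
  set w : ℝ → EuclideanSpace ℝ (Fin n) := fun t => z (max t₀ t) with hw
  have hw_of_le : ∀ {t}, t ≤ t₀ → w t = 0 := fun h => by simp [hw, max_eq_left h, hz0]
  have hw_of_ge : ∀ {t}, t₀ ≤ t → w t = z t := fun h => by simp [hw, max_eq_right h]
  have hgL : MemLp g 2 (volume.restrict (Icc 0 T)) :=
    (ContinuousOn.memLp_two_Icc (by fun_prop)).indicator measurableSet_Ioi
  have hstate : IsState F T g w := by
    refine ⟨by fun_prop, fun t ht => ?_⟩
    have e : ∀ s, Matrix.toEuclideanCLM (𝕜 := ℝ) F (w s) + g s =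
        (Ioi t₀).indicator (fun s => Matrix.toEuclideanCLM (𝕜 := ℝ) F (z s) - γ • p s) s := by
      intro s
      rcases le_or_gt s t₀ with hs | hs
      · simp [hg, hw_of_le hs, hs]
      · simp [hg, hw_of_ge hs.le, hs, sub_eq_add_neg]
    simp_rw [e]
    rw [intervalIntegral_indicator_Ioi _ ht₀.1 ht.1]
    rcases le_total t t₀ with h | h
    · rw [hw_of_le h, Ioc_eq_empty (not_lt.2 h)]; simp
    · rw [hw_of_ge h, ← intervalIntegral.integral_of_le h,
        intervalIntegral.integral_eq_sub_of_hasDerivAt (fun s _ => hz s)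
          (Continuous.intervalIntegrable (by fun_prop) _ _), hz0, sub_zero]
  -- After t₀ the running cost is −d/ds ⟪z, p⟫. The boundary term vanishes at t₀, and at T it
  -- cancels the terminal cost.
  have hcost : auxCost Qhat H γ T g w = 0 := by
    have e : ∀ s, -(inner ℝ (w s) (Matrix.toEuclideanCLM (𝕜 := ℝ) Qhat (w s)))
        + 1 / γ * ‖g s‖ ^ 2 = (Ioi t₀).indicator (fun s =>
          -(inner ℝ (z s) (Matrix.toEuclideanCLM (𝕜 := ℝ) Qhat (z s)
              - Matrix.toEuclideanCLM (𝕜 := ℝ) F.transpose (p s)) +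
            inner ℝ (Matrix.toEuclideanCLM (𝕜 := ℝ) F (z s) - γ • p s) (p s))) s := by
      intro s
      rcases le_or_gt s t₀ with hs | hs
      · simp [hg, hw_of_le hs, hs]
      · simp only [hg, hw_of_ge hs.le, indicator_of_mem (mem_Ioi.2 hs), inner_sub_left,
          inner_sub_right, inner_toEuclideanCLM_transpose, real_inner_smul_left,
          real_inner_self_eq_norm_sq, norm_neg, norm_smul, Real.norm_eq_abs, mul_pow, sq_abs]
        field_simp
        ring
    rw [auxCost]
    simp_rw [e]
    rw [intervalIntegral_indicator_Ioi _ ht₀.1 hT, ← intervalIntegral.integral_of_le ht₀.2,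
      intervalIntegral.integral_neg, intervalIntegral.integral_eq_sub_of_hasDerivAt
        (fun s _ => (hz s).inner ℝ (hp s)) (Continuous.intervalIntegrable (by fun_prop) _ _),
      hz0, hw_of_ge ht₀.2, hpT]
    simp
  have hle := hconv g w hgL hstate
  have e : ∀ s, ‖g s‖ ^ 2 = (Ioi t₀).indicator (fun s => ‖γ • p s‖ ^ 2) s := by
    intro s
    rcases le_or_gt s t₀ with hs | hs
    · simp [hg, hs]
    · simp [hg, hs]
  simp_rw [e] at hle
  rw [hcost, intervalIntegral_indicator_Ioi _ ht₀.1 hT,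
    ← intervalIntegral.integral_of_le ht₀.2] at hle
  have hint : ∫ s in t₀..T, ‖γ • p s‖ ^ 2 ≤ 0 := by
    by_contra! h
    linarith [mul_pos hε h]
  rcases ht₀.2.eq_or_lt with rfl | hlt
  · exact hz0
  have hp0 : ∀ t ∈ Icc t₀ T, p t = 0 := by
    intro t ht
    by_contra h
    have : 0 < ‖γ • p t‖ := norm_pos_iff.2 (smul_ne_zero hγ.ne' h)
    exact absurd hint (not_le.2 (intervalIntegral.integral_pos hlt (by fun_prop)
      (fun _ _ => by positivity) ⟨t, ht, by positivity⟩))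
  -- With p = 0 on [t₀, T], z solves ż = Fz from z(t₀) = 0.
  refine eq_zero_of_abs_deriv_le_mul_abs_self_of_eq_zero_right (a := t₀) (b := T)
    (K := ‖Matrix.toEuclideanCLM (𝕜 := ℝ) F‖) hzc.continuousOn
    (fun t _ => (hz t).hasDerivWithinAt) hz0 (fun t ht => ?_) T ⟨ht₀.2, le_rfl⟩
  rw [hp0 t (Ico_subset_Icc_self ht), smul_zero, sub_zero]
  exact ContinuousLinearMap.le_opNorm _ _

open scoped Matrix.Norms.L2Operator in
theorem HasDerivAt.toEuclideanCLM_apply_const {P : ℝ → Matrix (Fin n) (Fin n) ℝ}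
    {P' : Matrix (Fin n) (Fin n) ℝ} {t : ℝ} (h : HasDerivAt P P' t)
    (v : EuclideanSpace ℝ (Fin n)) :
    HasDerivAt (fun u => Matrix.toEuclideanCLM (𝕜 := ℝ) (P u) v)
      (Matrix.toEuclideanCLM (𝕜 := ℝ) P' v) t := by
  have h' := (hasDerivWithinAt_univ.2 h).toEuclideanCLM
  simpa using (hasDerivWithinAt_univ.1 h').clm_apply (hasDerivAt_const t v)

-- For v in the kernel of X(t₀), the pair z = Xv, p = (Y − HX)v is an extremal with z(t₀) = 0. It
-- must satisfy z(T) = 0, yet z(T) = v.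
open scoped Matrix.Norms.L2Operator in
theorem UniformConvexity.det_stateBlock_ne_zero (hH : H.transpose = H)
    (hconv : UniformConvexity F Qhat H γ T) (hγ : 0 < γ) :
    ∀ t ∈ Icc 0 T, (stateBlock F Qhat H γ T t).det ≠ 0 := by
  intro t₀ ht₀ hdet
  obtain ⟨v, hv0, hv⟩ := Matrix.exists_mulVec_eq_zero_iff.2 hdet
  have hX := hasDerivAt_stateBlock F Qhat H γ T
  have hY := hasDerivAt_costateBlock F Qhat H γ T
  have hT1 := stateBlock_self F Qhat H γ T
  have hT2 := costateBlock_self F Qhat H γ T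
  generalize stateBlock F Qhat H γ T = X at *
  generalize costateBlock F Qhat H γ T = Y at *
  have h := hconv.extremal_eq_zero hγ ht₀
    (z := fun t => Matrix.toEuclideanCLM (𝕜 := ℝ) (X t) (WithLp.toLp 2 v))
    (p := fun t => Matrix.toEuclideanCLM (𝕜 := ℝ) (Y t - H * X t) (WithLp.toLp 2 v))
    (fun t => by
      convert! (hX t).toEuclideanCLM_apply_const (WithLp.toLp 2 v) using 1
      rw [← toEuclideanCLM_mul_apply, ← smul_apply, ← map_smul, ← sub_apply, ← map_sub]
      congr 2
      simp only [add_mul, smul_mul_assoc, smul_sub]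
      abel)
    (fun t => by
      convert! ((hY t).sub ((hX t).const_mul H)).toEuclideanCLM_apply_const
        (WithLp.toLp 2 v) using 1
      rw [← toEuclideanCLM_mul_apply, ← toEuclideanCLM_mul_apply, ← sub_apply, ← map_sub]
      congr 2
      simp only [Matrix.transpose_add, Matrix.transpose_smul, hH, add_mul, mul_add, mul_sub,
        smul_mul_assoc, mul_smul_comm, pow_two, mul_assoc]
      abel)
    (by simp [Matrix.toEuclideanCLM_toLp, hv])
    (by simp [hT1, hT2])
  rw [hT1] at h
  exact hv0 (by simpa using h)

end euclidean

/-! ### The sign of the determinant and the equivalence. -/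

-- The determinant is continuous and equals 1 at T, so a nonpositive value would force a zero in
-- between.
open scoped Matrix.Norms.L2Operator in
theorem det_stateBlock_pos_iff {n : ℕ} {F Qhat H : Matrix (Fin n) (Fin n) ℝ} {γ T : ℝ} :
    (∀ t ∈ Icc 0 T, (stateBlock F Qhat H γ T t).det ≠ 0) ↔
      ∀ t ∈ Icc 0 T, 0 < (stateBlock F Qhat H γ T t).det := by
  refine ⟨fun h t ht => ?_, fun h t ht => (h t ht).ne'⟩
  have hc : Continuous fun t => (stateBlock F Qhat H γ T t).det :=
    (continuous_matrix fun i j => continuous_iff_continuousAt.2 fun t =>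
      (hasDerivWithinAt_univ.1 (hasDerivWithinAt_matrix_iff.1
        (hasDerivAt_stateBlock F Qhat H γ T t).hasDerivWithinAt i j)).continuousAt).matrix_det
  by_contra! hle
  obtain ⟨s, hs, hs0⟩ := intermediate_value_Icc ht.2 hc.continuousOn
    (show (0 : ℝ) ∈ Icc _ _ from ⟨hle, by simp [stateBlock_self]⟩)
  exact h s ⟨ht.1.trans hs.1, hs.2⟩ hs0

theorem forall_mem_Icc_sub_left {T : ℝ} {p : ℝ → Prop} :
    (∀ t ∈ Icc 0 T, p (T - t)) ↔ ∀ t ∈ Icc 0 T, p t := by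
  have hmem : ∀ t ∈ Icc 0 T, T - t ∈ Icc 0 T := fun t ht =>
    ⟨sub_nonneg.2 ht.2, sub_le_self T ht.1⟩
  exact ⟨fun h t ht => by simpa using h _ (hmem t ht), fun h t ht => h _ (hmem t ht)⟩

theorem mainTheorem8 (n : ℕ) (A G Γ Q H : Matrix (Fin n) (Fin n) ℝ) (γ T : ℝ)
    (hQ : Q.PosSemidef) (hH : H.PosSemidef) (hγ : 0 < γ) (hT : 0 < T) :
    [ UniformConvexity (A + G) (hatQ Q Γ) H γ T,
      RiccatiUniquelySolvable (A + G) (hatQ Q Γ) H γ T,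
      ∀ t ∈ Set.Icc (0 : ℝ) T,
        0 < (zeroOneRow n
              * NormedSpace.exp (t • hamiltonianMatrix (A + G) (hatQ Q Γ) H γ)
              * (zeroOneRow n).transpose).det ].TFAE := by
  have hH' : H.transpose = H := by simpa using hH.1.eq
  have hQ' : Q.transpose = Q := by simpa using hQ.1.eq
  have hQhat : (hatQ Q Γ).transpose = hatQ Q Γ := by
    simp [hatQ, Matrix.transpose_mul, hQ', mul_assoc]
  simp_rw [det_zeroOneRow_exp _ _ _ _ T hQhat hH',
    forall_mem_Icc_sub_left (p := fun t => 0 < (stateBlock (A + G) (hatQ Q Γ) H γ T t).det),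
    ← det_stateBlock_pos_iff]
  tfae_have 1 → 3 := fun h => h.det_stateBlock_ne_zero hH' hγ
  tfae_have 3 → 2 := fun h =>
    have hP := isRiccatiSolution_of_det_stateBlock_ne_zero hH' h
    ⟨_, hP, fun _ hR => hR.eqOn hP⟩
  -- The transpose of P solves the same problem, so uniqueness supplies the symmetry needed to
  -- complete the square.
  tfae_have 2 → 1 := fun ⟨_, hP, hu⟩ =>
    hP.uniformConvexity hγ hT (hu _ (hP.transpose hQhat hH'))
  tfae_finish
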